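/- A *metric group* is a group $G$ with a complete bi-invariant metric $d\le 1$. Let $\mathcal F=\{F_1,F_2,\dots\}$ be a family of continuity moduli, i.e. functions $F_n:(0,\infty)\to(0,\infty)$. A unitary representation $\pi$ of $G$ on a complex Hilbert space $\mathbf H$ is *$\mathcal F$-continuous* if for all $n\ge 1$, $\varepsilon>0$, $g,h\in G$ and $v\in\mathbf H$ with $\|v\|\le n$, $d(g,h)<F_n(\varepsilon)$ implies $\|\pi(g)v-\pi(h)v\|<\varepsilon$. A closed set $Q\subseteq G$ is an *$\mathcal F$-Kazhdan set* if there is $\varepsilon>0$ such that every $\mathcal F$-continuous unitary representation $\pi$ of $G$ on a complex Hilbert space that admits a unit vector $v$ with $\sup_{x\in Q}\|\pi(x)v-v\|<\varepsilon$ has a non-zero $G$-invariant vector. The group $G$ has *property $\mathcal F$-non-(T)* if it has no compact $\mathcal F$-Kazhdan subset. The *density character* of a topological space is the smallest cardinality of a dense subset. **Corollary.** For every family $\mathcal F$ of continuity moduli, the class of locally compact metric groups with property $\mathcal F$-non-(T) is bountiful: if $H$ belongs to this class and $C\subseteq H$ is an infinite subset, then there is a closed subgroup $K\le H$ with $C\subseteq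 K$ such that $K$, with the restricted metric, is a locally compact metric group with property $\mathcal F$-non-(T), and the density character of $K$ equals the density character of $C$. -/

import Mathlib

universe u

/-- The density character of a topological space: the smallest cardinality of a dense subset. -/
noncomputable def densityCharacter (X : Type u) [TopologicalSpace X] : Cardinal.{u} :=
  sInf {κ : Cardinal.{u} | ∃ D : Set X, Dense D ∧ Cardinal.mk D = κ}

/-- A metric group, as a structure of continuous logic: a group with a complete bi-invariant
metric of diameter at most `1`.  (Such a group is a topological group automatically.) -/
structure IsMetricGroup (G : Type u) [Group G] [MetricSpace G] : Prop where
  complete : CompleteSpace G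
  dist_mul_left : ∀ g x y : G, dist (g * x) (g * y) = dist x y
  dist_mul_right : ∀ g x y : G, dist (x * g) (y * g) = dist x y
  dist_le_one : ∀ x y : G, dist x y ≤ 1

/-- A family `F` of continuity moduli: for every `n ≥ 1` a function `F n` which assigns a positive
number to every positive number. -/
def IsModulusFamily (F : ℕ → ℝ → ℝ) : Prop :=
  ∀ n : ℕ, 1 ≤ n → ∀ ε : ℝ, 0 < ε → 0 < F n ε

/-- A unitary representation `π` of the metric group `G` on the Hilbert space `E` is
`F`-continuous if, for every `n ≥ 1`, the function `F n` is a continuity modulus for the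
`G`-variable of the action `G × Bₙ → Bₙ` on the ball `Bₙ` of vectors of norm at most `n`. -/
def IsModulusContinuous (F : ℕ → ℝ → ℝ) {G : Type u} [Group G] [MetricSpace G]
    {E : Type u} [NormedAddCommGroup E] [InnerProductSpace ℂ E] (π : G →* (E ≃ₗᵢ[ℂ] E)) : Prop :=
  ∀ n : ℕ, 1 ≤ n → ∀ ε : ℝ, 0 < ε → ∀ g h : G, dist g h < F n ε →
    ∀ v : E, ‖v‖ ≤ n → ‖π g v - π h v‖ < ε

/-- The set `Q` has an almost `ε`-invariant unit vector for the unitary representation `π`.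
(The supremum is over numbers in `[0, 2]`, and is `0` for empty `Q`.) -/
def HasAlmostInvariantUnitVector {G : Type u} [Group G]
    {E : Type u} [NormedAddCommGroup E] [InnerProductSpace ℂ E] (π : G →* (E ≃ₗᵢ[ℂ] E))
    (Q : Set G) (ε : ℝ) : Prop :=
  ∃ v : E, ‖v‖ = 1 ∧ (⨆ x : Q, ‖π (x : G) v - v‖) < ε

/-- The closed set `Q` is an `F`-Kazhdan subset of `G`: there is `ε > 0` such that every
`F`-continuous unitary representation of `G` on a complex Hilbert space for which `Q` has an almost
`ε`-invariant unit vector has a non-zero invariant vector.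

It is no restriction that the Hilbert spaces live in the universe of `G`: for a unit vector `v` of a
representation without non-zero invariant vectors, the closed span of the orbit of `v` is again
such a representation, and it is spanned by at most `|G|` vectors. -/
def IsKazhdanSubset (F : ℕ → ℝ → ℝ) {G : Type u} [Group G] [MetricSpace G] (Q : Set G) : Prop :=
  IsClosed Q ∧ ∃ ε : ℝ, 0 < ε ∧
    ∀ (E : Type u) [NormedAddCommGroup E] [InnerProductSpace ℂ E] [CompleteSpace E]
      (π : G →* (E ≃ₗᵢ[ℂ] E)), IsModulusContinuous F π →
      HasAlmostInvariantUnitVector π Q ε → ∃ w : E, w ≠ 0 ∧ ∀ g : G, π g w = w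

/-- Property `F`-non-(T): there is no compact `F`-Kazhdan subset. -/
def IsNonT (F : ℕ → ℝ → ℝ) (G : Type u) [Group G] [MetricSpace G] : Prop :=
  ¬ ∃ Q : Set G, IsCompact Q ∧ IsKazhdanSubset F Q

/-- A class `𝒦` of groups with a metric is bountiful if every infinite subset `C` of a member `H`
of `𝒦` lies in a closed subgroup `K` of `H` which, with the metric of `H`, belongs to `𝒦` and
has the same density character as `C`.  (As `C` is infinite, so is `H`.) -/
def IsBountiful (𝒦 : ∀ (G : Type u) [Group G] [MetricSpace G], Prop) : Prop :=
  ∀ (H : Type u) [Group H] [MetricSpace H], 𝒦 H → ∀ C : Set H, C.Infinite →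
    ∃ K : Subgroup H, C ⊆ (K : Set H) ∧ IsClosed (K : Set H) ∧ 𝒦 K ∧
      densityCharacter C = densityCharacter K

/-! The argument is of Löwenheim–Skolem type: each failure of the Kazhdan condition is witnessed by
countably many group elements, and a subgroup closed under choosing witnesses inherits all the
failures. Absence of fixed vectors need not pass to subgroups, but a weaker form does. If `π` has no
non-zero fixed vector, the point of least norm in the closed convex hull of the orbit of `v` is
fixed, hence `0`, and countably many orbit points suffice to have `0` in their closed convex hull.
In a subgroup containing the corresponding elements, every fixed vector is orthogonal to `v`, so `v`
lives in the complement of the fixed vectors (`HasNonKazhdanRep.exists_seq`). By local compactness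
and invariance of the metric, it is enough to treat finite unions of closed balls of one fixed
radius and tolerances `1 / (n + 1)`. Finite tuples of centres then index the witnesses, so closing
under them does not raise an infinite cardinality (`IsNonT.exists_subgroup`). -/

open Cardinal

/-! ### Density character of metric spaces -/

section Density

theorem exists_dense_mk_eq_densityCharacter (X : Type u) [TopologicalSpace X] :
    ∃ D : Set X, Dense D ∧ #D = densityCharacter X :=
  csInf_mem (s := {κ : Cardinal.{u} | ∃ D : Set X, Dense D ∧ #D = κ})
    ⟨_, Set.univ, dense_univ, rfl⟩

theorem densityCharacter_le {X : Type u} [TopologicalSpace X] {D : Set X} (hD : Dense D) :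
    densityCharacter X ≤ #D :=
  csInf_le' ⟨D, hD, rfl⟩

theorem aleph0_le_densityCharacter (X : Type u) [TopologicalSpace X] [T1Space X] [Infinite X] :
    ℵ₀ ≤ densityCharacter X := by
  obtain ⟨D, hD, h⟩ := exists_dense_mk_eq_densityCharacter X
  rw [← h, ← not_lt, Cardinal.lt_aleph0_iff_set_finite]
  intro hfin
  have huniv : D = Set.univ := by rw [← hfin.isClosed.closure_eq, hD.closure_eq]
  exact Set.infinite_univ (huniv ▸ hfin)

theorem densityCharacter_le_of_isometry {X Y : Type u} [MetricSpace X] [MetricSpace Y]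
    [Infinite X] {f : Y → X} (hf : Isometry f) : densityCharacter Y ≤ densityCharacter X := by
  classical
  rcases isEmpty_or_nonempty Y with hY | ⟨⟨y₀⟩⟩
  · exact (densityCharacter_le (D := ∅) (fun y => hY.elim y)).trans (by simp)
  obtain ⟨D, hD, h⟩ := exists_dense_mk_eq_densityCharacter X
  have hinf : ℵ₀ ≤ #D := h ▸ aleph0_le_densityCharacter X
  -- A dense subset of `Y`: for each `d ∈ D` and `n`, one point of `Y` within `1 / (n + 1)` of `d`,
  -- if there is any; `y₀` is a dummy value.
  let g : D × ℕ → Y := fun p =>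
    if hp : ∃ y, dist (f y) p.1 < 1 / (p.2 + 1 : ℝ) then hp.choose else y₀
  have hg : Dense (Set.range g) := by
    rw [Metric.dense_iff]
    intro y r hr
    obtain ⟨n, hn⟩ := exists_nat_one_div_lt (half_pos hr)
    obtain ⟨d, hd, hdD⟩ := Metric.dense_iff.1 hD (f y) (1 / (n + 1 : ℝ)) (by positivity)
    rw [Metric.mem_ball, dist_comm] at hd
    have hp : ∃ y, dist (f y) (((⟨d, hdD⟩, n) : D × ℕ).1 : X)
        < 1 / ((((⟨d, hdD⟩, n) : D × ℕ).2 : ℝ) + 1) := ⟨y, hd⟩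
    refine ⟨g (⟨d, hdD⟩, n), ?_, ⟨_, rfl⟩⟩
    have hspec := hp.choose_spec
    have hgv : g (⟨d, hdD⟩, n) = hp.choose := dif_pos hp
    rw [Metric.mem_ball, hgv, ← hf.dist_eq]
    have htri := dist_triangle_right (f hp.choose) (f y) d
    simp only at hspec
    linarith
  calc densityCharacter Y ≤ #(Set.range g) := densityCharacter_le hg
    _ ≤ #(D × ℕ) := mk_range_le
    _ = #D := by rw [mk_prod, lift_uzero, mk_nat, lift_aleph0, mul_eq_left hinf hinf aleph0_ne_zero]
    _ = _ := h

end Density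

/-- A set is contained in a set closed under countably many finitary operations, without increase
of its (infinite) cardinality. -/
theorem exists_closed_under_operations {H : Type u} (I : ℕ → Type) [∀ k, Countable (I k)]
    (f : ∀ k, I k → (Fin k → H) → H) (D : Set H) :
    ∃ S : Set H, D ⊆ S ∧ #S ≤ max ℵ₀ #D ∧
      ∀ k (i : I k) (x : Fin k → H), (∀ j, x j ∈ S) → f k i x ∈ S := by
  -- With the operations as function symbols, the set sought is the substructure generated by `D`.
  let L : FirstOrder.Language.{0, 0} := ⟨I, fun _ => Empty⟩
  let : L.Structure H :=
    { funMap := fun {k} i x => f k i x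
      RelMap := fun r => r.elim }
  refine ⟨FirstOrder.Language.Substructure.closure L D,
    FirstOrder.Language.Substructure.subset_closure, ?_,
    fun k i x hx => (FirstOrder.Language.Substructure.closure L D).fun_mem (n := k) i x hx⟩
  have h := FirstOrder.Language.Substructure.lift_card_closure_le (L := L) (s := D)
  have hc : #(Σ k, L.Functions k) ≤ ℵ₀ :=
    Cardinal.mk_le_aleph0_iff.2 (inferInstanceAs (Countable (Σ k, I k)))
  have hc' : Cardinal.lift.{u} #(Σ k, L.Functions k) ≤ ℵ₀ :=
    Cardinal.lift_le_aleph0.2 hc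
  simp only [Cardinal.lift_id'] at h
  refine h.trans (max_le (le_max_left _ _) ?_)
  exact Cardinal.add_le_of_le (le_max_left _ _) (le_max_right _ _) (hc'.trans (le_max_left _ _))

/-! ### Fixed vectors of unitary representations -/

section Representation

variable {G : Type u} [Group G] {E : Type u} [NormedAddCommGroup E] [InnerProductSpace ℂ E]

theorem UnitaryRep.exists_fixed_mem_closure_convexHull [CompleteSpace E]
    (π : G →* (E ≃ₗᵢ[ℂ] E)) (v : E) :
    ∃ w ∈ closure (convexHull ℝ (Set.range fun g => π g v)), ∀ g, π g w = w := by
  let : InnerProductSpace ℝ E := InnerProductSpace.complexToReal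
  set T := Set.range fun g => π g v
  have hconv : Convex ℝ (closure (convexHull ℝ T)) := (convex_convexHull ℝ T).closure
  have hne : (closure (convexHull ℝ T)).Nonempty :=
    ⟨v, subset_closure (subset_convexHull ℝ T ⟨1, by simp⟩)⟩
  obtain ⟨w, hw, hmin⟩ :=
    exists_norm_eq_iInf_of_complete_convex hne isClosed_closure.isComplete hconv 0
  refine ⟨w, hw, fun g => ?_⟩
  have hmaps : Set.MapsTo (π g) (convexHull ℝ T) (convexHull ℝ T) := by
    have hlin : IsLinearMap ℝ (π g) := ⟨map_add _, fun c x => map_real_smul (π g) (π g).continuous c x⟩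
    rw [Set.mapsTo_iff_image_subset, hlin.image_convexHull]
    refine convexHull_mono ?_
    rintro _ ⟨_, ⟨h, rfl⟩, rfl⟩
    exact ⟨g * h, by simp⟩
  have hgw : π g w ∈ closure (convexHull ℝ T) := hmaps.closure (π g).continuous hw
  -- Minimality gives `‖w‖² ≤ ⟪w, π g w⟫`; as both vectors have the same norm, they coincide.
  have h := (norm_eq_iInf_iff_real_inner_le_zero hconv hw).1 hmin (π g w) hgw
  rw [zero_sub, inner_neg_left, inner_sub_right, real_inner_self_eq_norm_sq] at h
  have hsq := norm_sub_sq_real w (π g w)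
  rw [(π g).norm_map] at hsq
  have hz : ‖w - π g w‖ = 0 := by nlinarith [norm_nonneg (w - π g w)]
  exact (sub_eq_zero.1 (norm_eq_zero.1 hz)).symm

theorem inner_eq_of_mem_closure_convexHull {T : Set E} {w : E} {c : ℂ}
    (hT : ∀ x ∈ T, inner ℂ w x = c) {z : E} (hz : z ∈ closure (convexHull ℝ T)) :
    inner ℂ w z = c := by
  have hcl : IsClosed {x : E | inner ℂ w x = c} :=
    isClosed_eq (by fun_prop) continuous_const
  have hcv : Convex ℝ {x : E | inner ℂ w x = c} := by
    intro x hx y hy a b _ _ hab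
    simp only [Set.mem_ofPred_eq] at hx hy ⊢
    rw [inner_add_right, inner_smul_right_eq_smul, inner_smul_right_eq_smul, hx, hy, ← add_smul,
      hab, one_smul]
  exact closure_minimal (convexHull_min hT hcv) hcl hz

theorem exists_countable_subset_mem_closure_convexHull {T : Set E} {z : E}
    (hz : z ∈ closure (convexHull ℝ T)) :
    ∃ T' ⊆ T, T'.Countable ∧ z ∈ closure (convexHull ℝ T') := by
  have h (n : ℕ) : ∃ t : Finset E, ↑t ⊆ T ∧
      ∃ c ∈ convexHull ℝ (t : Set E), dist z c < 1 / (n + 1 : ℝ) := by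
    obtain ⟨c, hc, hd⟩ := Metric.mem_closure_iff.1 hz (1 / (n + 1 : ℝ)) (by positivity)
    rw [convexHull_eq_union_convexHull_finite_subsets] at hc
    simp only [Set.mem_iUnion] at hc
    obtain ⟨t, ht, hct⟩ := hc
    exact ⟨t, ht, c, hct, hd⟩
  choose t htT c hc hd using h
  refine ⟨⋃ n, (t n : Set E), Set.iUnion_subset htT,
    Set.countable_iUnion fun n => (t n).countable_toSet, Metric.mem_closure_iff.2 fun ε hε => ?_⟩
  obtain ⟨n, hn⟩ := exists_nat_one_div_lt hε
  exact ⟨c n, convexHull_mono (Set.subset_iUnion (fun n => (t n : Set E)) n) (hc n),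
    (hd n).trans hn⟩

/-- If a unitary representation has no non-zero fixed vectors, then for every vector `v` this is
witnessed, in the direction of `v`, by countably many group elements. -/
theorem UnitaryRep.exists_seq_inner_eq_zero [CompleteSpace E] {π : G →* (E ≃ₗᵢ[ℂ] E)}
    (hπ : ∀ w, (∀ g, π g w = w) → w = 0) (v : E) :
    ∃ h : ℕ → G, ∀ w, (∀ m, π (h m) w = w) → inner ℂ w v = 0 := by
  obtain ⟨z, hz, hfix⟩ := UnitaryRep.exists_fixed_mem_closure_convexHull π v
  obtain rfl := hπ z hfix
  obtain ⟨T', hT', hcount, hz'⟩ := exists_countable_subset_mem_closure_convexHull hz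
  have hne : T'.Nonempty := by
    by_contra hemp
    simp [Set.not_nonempty_iff_eq_empty.1 hemp] at hz'
  obtain ⟨x, rfl⟩ := hcount.exists_eq_range hne
  choose h hh using fun m => hT' ⟨m, rfl⟩
  refine ⟨h, fun w hw => ?_⟩
  -- Pairing with `w` takes the constant value `inner ℂ w v` on the chosen orbit points, hence on
  -- their closed convex hull, which contains `0`.
  rw [← inner_eq_of_mem_closure_convexHull (w := w) (c := inner ℂ w v) ?_ hz', inner_zero_right]
  rintro _ ⟨m, rfl⟩
  rw [← hh m]
  conv_lhs => rw [← hw m]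
  exact (π (h m)).inner_map_map w v

/-- The vectors fixed by a unitary representation. -/
def UnitaryRep.fixed (π : G →* (E ≃ₗᵢ[ℂ] E)) : Submodule ℂ E where
  carrier := {w | ∀ g, π g w = w}
  add_mem' hx hy g := by rw [map_add, hx g, hy g]
  zero_mem' g := map_zero _
  smul_mem' c x hx g := by rw [map_smul, hx g]

theorem UnitaryRep.mem_orthogonal_fixed (π : G →* (E ≃ₗᵢ[ℂ] E)) (g : G) {x : E}
    (hx : x ∈ (UnitaryRep.fixed π)ᗮ) : π g x ∈ (UnitaryRep.fixed π)ᗮ := by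
  rw [Submodule.mem_orthogonal] at hx ⊢
  intro w hw
  rw [← hx w hw]
  conv_lhs => rw [← hw g]
  exact (π g).inner_map_map w x

/-- The restriction of a unitary representation to the orthogonal complement of its fixed
vectors. -/
def UnitaryRep.orthogonalFixed (π : G →* (E ≃ₗᵢ[ℂ] E)) :
    G →* ((UnitaryRep.fixed π)ᗮ ≃ₗᵢ[ℂ] (UnitaryRep.fixed π)ᗮ) where
  toFun g :=
    { toFun := fun x => ⟨π g x, UnitaryRep.mem_orthogonal_fixed π g x.2⟩
      invFun := fun x => ⟨π g⁻¹ x, UnitaryRep.mem_orthogonal_fixed π g⁻¹ x.2⟩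
      map_add' := fun x y => Subtype.ext (map_add (π g) (x : E) y)
      map_smul' := fun c x => Subtype.ext (map_smul (π g) c (x : E))
      left_inv := fun x => Subtype.ext (by simp)
      right_inv := fun x => Subtype.ext (by simp)
      norm_map' := fun x => (π g).norm_map x }
  map_one' := by ext x; simp
  map_mul' g h := by ext x; simp

@[simp]
theorem UnitaryRep.coe_orthogonalFixed (π : G →* (E ≃ₗᵢ[ℂ] E)) (g : G)
    (x : (UnitaryRep.fixed π)ᗮ) : (UnitaryRep.orthogonalFixed π g x : E) = π g x :=
  rfl

theorem UnitaryRep.orthogonalFixed_eq_zero (π : G →* (E ≃ₗᵢ[ℂ] E)) (x : (UnitaryRep.fixed π)ᗮ)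
    (hx : ∀ g, UnitaryRep.orthogonalFixed π g x = x) : x = 0 := by
  have hmem : (x : E) ∈ UnitaryRep.fixed π := fun g => congrArg Subtype.val (hx g)
  exact Subtype.ext (inner_self_eq_zero.1 (x.2 x hmem))

theorem UnitaryRep.norm_sub_le_two (π : G →* (E ≃ₗᵢ[ℂ] E)) (g : G) {v : E} (hv : ‖v‖ = 1) :
    ‖π g v - v‖ ≤ 2 := by
  refine (norm_sub_le _ _).trans ?_
  rw [(π g).norm_map, hv]
  norm_num

theorem HasAlmostInvariantUnitVector.of_forall_exists {G' E' : Type u} [Group G']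
    [NormedAddCommGroup E'] [InnerProductSpace ℂ E']
    {π : G →* (E ≃ₗᵢ[ℂ] E)} {v : E} (hv : ‖v‖ = 1) {Q : Set G} {ε : ℝ}
    (h : (⨆ x : Q, ‖π (x : G) v - v‖) < ε) {ρ : G' →* (E' ≃ₗᵢ[ℂ] E')} {v' : E'} (hv' : ‖v'‖ = 1)
    {Q' : Set G'} {ε' : ℝ} (hε : ε ≤ ε')
    (hQ : ∀ y ∈ Q', ∃ x ∈ Q, ‖ρ y v' - v'‖ ≤ ‖π x v - v‖) :
    HasAlmostInvariantUnitVector ρ Q' ε' := by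
  -- Boundedness matters: a real supremum over an unbounded set is `0` by default and would bound
  -- nothing.
  have hbdd : BddAbove (Set.range fun x : Q => ‖π (x : G) v - v‖) :=
    ⟨2, by rintro _ ⟨x, rfl⟩; exact UnitaryRep.norm_sub_le_two π x hv⟩
  refine ⟨v', hv', lt_of_le_of_lt ?_ (h.trans_le hε)⟩
  refine Real.iSup_le (fun y => ?_) (Real.iSup_nonneg fun x => norm_nonneg _)
  obtain ⟨x, hx, hle⟩ := hQ y y.2
  exact hle.trans (le_ciSup hbdd ⟨x, hx⟩)

theorem HasAlmostInvariantUnitVector.mono {π : G →* (E ≃ₗᵢ[ℂ] E)} {Q Q' : Set G} {ε ε' : ℝ}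
    (h : HasAlmostInvariantUnitVector π Q ε) (hQ : Q' ⊆ Q) (hε : ε ≤ ε') :
    HasAlmostInvariantUnitVector π Q' ε' := by
  obtain ⟨v, hv, hlt⟩ := h
  exact .of_forall_exists hv hlt hv hε fun y hy => ⟨y, hQ hy, le_rfl⟩

end Representation

/-! ### Passing failures of the Kazhdan condition to subgroups -/

section NonT

variable {F : ℕ → ℝ → ℝ}

/-- There is an `F`-continuous unitary representation of `G` with a unit vector which is almost
`ε`-invariant under `Q`, but without non-zero invariant vectors. -/
def HasNonKazhdanRep (F : ℕ → ℝ → ℝ) {G : Type u} [Group G] [MetricSpace G] (Q : Set G)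
    (ε : ℝ) : Prop :=
  ∃ (E : Type u) (_ : NormedAddCommGroup E) (_ : InnerProductSpace ℂ E) (_ : CompleteSpace E)
    (π : G →* (E ≃ₗᵢ[ℂ] E)), IsModulusContinuous F π ∧ HasAlmostInvariantUnitVector π Q ε ∧
      ∀ w, (∀ g, π g w = w) → w = 0

theorem isNonT_iff {G : Type u} [Group G] [MetricSpace G] :
    IsNonT F G ↔ ∀ Q : Set G, IsCompact Q → ∀ ε : ℝ, 0 < ε → HasNonKazhdanRep F Q ε := by
  constructor
  · intro h Q hQ ε hε
    by_contra hno
    refine h ⟨Q, hQ, hQ.isClosed, ε, hε, fun E _ _ _ π hπ hinv => ?_⟩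
    by_contra hfix
    refine hno ⟨E, _, _, inferInstance, π, hπ, hinv, fun w hw => ?_⟩
    by_contra hw0
    exact hfix ⟨w, hw0, hw⟩
  · rintro h ⟨Q, hQ, -, ε, hε, hK⟩
    obtain ⟨E, _, _, _, π, hπ, hinv, hfix⟩ := h Q hQ ε hε
    obtain ⟨w, hw0, hw⟩ := hK E π hπ hinv
    exact hw0 (hfix w hw)

theorem HasNonKazhdanRep.mono {G : Type u} [Group G] [MetricSpace G] {Q Q' : Set G} {ε ε' : ℝ}
    (h : HasNonKazhdanRep F Q ε) (hQ : Q' ⊆ Q) (hε : ε ≤ ε') : HasNonKazhdanRep F Q' ε' := by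
  obtain ⟨E, _, _, _, π, hπ, hinv, hfix⟩ := h
  exact ⟨E, _, _, inferInstance, π, hπ, hinv.mono hQ hε, hfix⟩

/-- The failure of the Kazhdan condition for `(Q, ε)` passes to every subgroup that contains
a suitable sequence of group elements. -/
theorem HasNonKazhdanRep.exists_seq {G : Type u} [Group G] [MetricSpace G] {Q : Set G} {ε : ℝ}
    (h : HasNonKazhdanRep F Q ε) :
    ∃ s : ℕ → G, ∀ K : Subgroup G, (∀ m, s m ∈ K) →
      HasNonKazhdanRep F ((↑) ⁻¹' Q : Set K) ε := by
  obtain ⟨E, _, _, _, π, hπ, ⟨v, hv, hlt⟩, hfix⟩ := h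
  obtain ⟨s, hs⟩ := UnitaryRep.exists_seq_inner_eq_zero hfix v
  refine ⟨s, fun K hK => ?_⟩
  have hvmem : v ∈ (UnitaryRep.fixed (π.comp K.subtype))ᗮ :=
    (Submodule.mem_orthogonal _ _).2 fun w hw => hs w fun m => hw ⟨s m, hK m⟩
  refine ⟨_, _, _, inferInstance, UnitaryRep.orthogonalFixed (π.comp K.subtype), ?_, ?_,
    UnitaryRep.orthogonalFixed_eq_zero _⟩
  · intro n hn δ hδ g k hgk x hx
    exact hπ n hn δ hδ g k hgk x hx
  · exact .of_forall_exists hv hlt (v' := ⟨v, hvmem⟩) hv le_rfl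
      fun y hy => ⟨y, hy, le_rfl⟩

end NonT

/-! ### Metric groups and compact balls -/

section MetricGroup

variable {G : Type u} [Group G] [MetricSpace G]

theorem IsMetricGroup.isTopologicalGroup (hG : IsMetricGroup G) : IsTopologicalGroup G where
  continuous_mul := by
    refine (LipschitzWith.of_dist_le_mul (K := 2) fun p q => ?_).continuous
    have h1 := dist_triangle (p.1 * p.2) (q.1 * p.2) (q.1 * q.2)
    rw [hG.dist_mul_left, hG.dist_mul_right] at h1
    have h2 : dist p.1 q.1 ≤ dist p q := le_max_left _ _
    have h3 : dist p.2 q.2 ≤ dist p q := le_max_right _ _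
    push_cast
    linarith
  continuous_inv := by
    refine (Isometry.of_dist_eq fun x y => ?_).continuous
    rw [← hG.dist_mul_left x, ← hG.dist_mul_right y, mul_inv_cancel, one_mul,
      inv_mul_cancel_right, dist_comm]

theorem IsMetricGroup.subgroup (hG : IsMetricGroup G) {K : Subgroup G}
    (hK : IsClosed (K : Set G)) : IsMetricGroup K where
  complete := have := hG.complete; hK.completeSpace_coe
  dist_mul_left g x y := hG.dist_mul_left g x y
  dist_mul_right g x y := hG.dist_mul_right g x y
  dist_le_one x y := hG.dist_le_one x y

/-- Left translations are isometries, so a radius that works at `1` works at every centre. -/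
theorem IsMetricGroup.exists_isCompact_closedBall (hG : IsMetricGroup G) [LocallyCompactSpace G] :
    ∃ r : ℝ, 0 < r ∧ ∀ a : G, IsCompact (Metric.closedBall a r) := by
  obtain ⟨r, hr, hc⟩ := Metric.exists_isCompact_closedBall (1 : G)
  refine ⟨r, hr, fun a => ?_⟩
  have := hG.isTopologicalGroup
  convert hc.image (continuous_const_mul a) using 1
  ext x
  simp only [Set.image_mul_left, Set.mem_preimage, Metric.mem_closedBall]
  rw [← hG.dist_mul_left a⁻¹ x a, inv_mul_cancel]

end MetricGroup

/-- Working with all `K` between `S` and its closure lets compact subsets of `K` be covered by balls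
centred in the small group `S`. -/
theorem IsNonT.exists_subgroup {F : ℕ → ℝ → ℝ} {H : Type u} [Group H] [MetricSpace H]
    (hH : IsMetricGroup H) [LocallyCompactSpace H] (hT : IsNonT F H) (D : Set H) :
    ∃ S : Subgroup H, D ⊆ S ∧ #S ≤ max ℵ₀ #D ∧
      ∀ K : Subgroup H, S ≤ K → (K : Set H) ⊆ closure S → IsNonT F K := by
  obtain ⟨r, hr, hball⟩ := hH.exists_isCompact_closedBall
  rw [isNonT_iff] at hT
  choose s hs using fun (k : ℕ) (x : Fin k → H) (n : ℕ) =>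
    (hT (⋃ j, Metric.closedBall (x j) r) (isCompact_iUnion fun j => hball (x j))
      (1 / (n + 1 : ℝ)) (by positivity)).exists_seq
  -- `some (n, m)` yields the `m`-th witness for tolerance `1 / (n + 1)`; `none` yields division in
  -- arity `2` and `1` otherwise, which makes the closed set a subgroup.
  let f : ∀ k, Option (ℕ × ℕ) → (Fin k → H) → H := fun k i x =>
    match i with
    | some (n, m) => s k x n m
    | none => if hk : k = 2 then x ⟨0, by omega⟩ * (x ⟨1, by omega⟩)⁻¹ else 1
  obtain ⟨S, hDS, hcard, hcl⟩ := exists_closed_under_operations (fun _ => Option (ℕ × ℕ)) f D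
  have hone : (1 : H) ∈ S := by
    simpa [f] using hcl 0 none Fin.elim0 (fun j => j.elim0)
  have hdiv : ∀ x ∈ S, ∀ y ∈ S, x * y⁻¹ ∈ S := fun x hx y hy => by
    simpa [f] using hcl 2 none ![x, y] (by simp [Fin.forall_fin_two, hx, hy])
  refine ⟨Subgroup.ofDiv S ⟨1, hone⟩ hdiv, hDS, hcard, fun K hSK hKS => ?_⟩
  change S ⊆ (K : Set H) at hSK
  change (K : Set H) ⊆ closure S at hKS
  rw [isNonT_iff]
  intro Q hQ ε hε
  obtain ⟨n, hn⟩ := exists_nat_one_div_lt hε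
  have hQ' : IsCompact ((↑) '' Q : Set H) := hQ.image continuous_subtype_val
  obtain ⟨t, ht⟩ := hQ'.elim_finite_subcover (fun a : S => Metric.ball (a : H) r)
    (fun a => Metric.isOpen_ball) (by
      rintro _ ⟨q, -, rfl⟩
      obtain ⟨a, ha, hd⟩ := Metric.mem_closure_iff.1 (hKS q.2) r hr
      exact Set.mem_iUnion.2 ⟨⟨a, ha⟩, hd⟩)
  let x : Fin t.card → H := fun j => (t.equivFin.symm j : S)
  have hx (j) : x j ∈ S := (t.equivFin.symm j : S).2
  refine (hs _ x n K fun m => hSK (hcl _ (some (n, m)) x hx)).mono (fun q hq => ?_) hn.le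
  obtain ⟨a, hat, hqa⟩ := Set.mem_iUnion₂.1 (ht ⟨q, hq, rfl⟩)
  refine Set.mem_iUnion.2 ⟨t.equivFin ⟨a, hat⟩, ?_⟩
  simpa [x] using (Metric.mem_ball.1 hqa).le

theorem corollary2p3 (F : ℕ → ℝ → ℝ) (hF : IsModulusFamily F) :
    IsBountiful.{u} (fun G [Group G] [MetricSpace G] =>
      IsMetricGroup G ∧ LocallyCompactSpace G ∧ IsNonT F G) := by
  rintro H _ _ ⟨hH, hloc, hT⟩ C hC
  have := hH.isTopologicalGroup
  have hCinf : Infinite C := hC.to_subtype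
  -- Starting from `D` rather than `C` bounds `#S` by the density character of `C`; taking the
  -- closure recovers `C`.
  obtain ⟨D, hD, hDcard⟩ := exists_dense_mk_eq_densityCharacter C
  obtain ⟨S, hDS, hcard, hS⟩ := hT.exists_subgroup hH ((↑) '' D : Set H)
  set K := S.topologicalClosure
  have hSK : S ≤ K := S.le_topologicalClosure
  have hK : IsClosed (K : Set H) := S.isClosed_topologicalClosure
  have hCK : C ⊆ (K : Set H) := fun c hc => by
    have h : (c : H) ∈ (↑) '' closure D := ⟨⟨c, hc⟩, hD _, rfl⟩
    exact closure_mono hDS (image_closure_subset_closure_image continuous_subtype_val h)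
  have hKinf : Infinite K := (hC.mono hCK).to_subtype
  refine ⟨K, hCK, hK, ⟨hH.subgroup hK, hK.isClosedEmbedding_subtypeVal.locallyCompactSpace,
    hS K hSK subset_rfl⟩, le_antisymm ?_ ?_⟩
  · exact densityCharacter_le_of_isometry (f := Set.inclusion hCK) fun _ _ => rfl
  · have hdense : Dense (Set.range (Subgroup.inclusion hSK)) := by
      rw [Subtype.dense_iff]
      intro x hx
      convert! show x ∈ closure (S : Set H) from hx
      ext y
      constructor
      · rintro ⟨_, ⟨z, rfl⟩, rfl⟩
        exact z.2
      · exact fun hy => ⟨_, ⟨⟨y, hy⟩, rfl⟩, rfl⟩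
    calc densityCharacter K ≤ #(Set.range (Subgroup.inclusion hSK)) := densityCharacter_le hdense
      _ ≤ #S := mk_range_le
      _ ≤ max ℵ₀ #((↑) '' D : Set H) := hcard
      _ ≤ max ℵ₀ #D := max_le_max le_rfl mk_image_le
      _ = densityCharacter C := by rw [hDcard, max_eq_right (aleph0_le_densityCharacter C)]
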